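/- For words $u,v$ over an alphabet $\Sigma$ (a finite non-empty set), let $\binom{u}{v}$ be the number of occurrences of $v$ as a scattered factor of $u$, i.e. the number of sequences of positions $i_1<\dots<i_m$ in $u$, $m=|v|$, with $u[i_1]\cdots u[i_m]=v$. Two words $w_1,w_2\in\Sigma^*$ are $k$-binomial equivalent, $w_1\equiv_k w_2$, if $\binom{w_1}{x}=\binom{w_2}{x}$ for every $x\in\Sigma^*$ with $|x|\le k$. Consider the unit-cost word RAM with word size $W$: registers and $2^W$ memory cells each hold a $W$-bit word, and the instructions, each of cost one, are word arithmetic modulo $2^W$ (addition, subtraction, multiplication, division, remainder, shifts, bitwise operations, comparisons), loading constants, register copy, indirect load and store, conditional and unconditional branches, subroutine call and return, and halting with answer yes or no. Theorem. The problem "given $w_1,w_2\in\Sigma^*$ with $|w_1|=|w_2|=n$ and $k\le n$, decide whether $w_1\equiv_k w_2$" can be solved in deterministic polynomial time on the unit-cost RAM with word size $\Omega(\log n)$. Precisely: there are a fixed program, a constant $c$ and a polynomial $p$ such that, for every alphabet $\Sigma$, all $n$, all $k\le n$, all $w_1,w_2\in\Sigma^*$ of length $n$, every word size $W\ge c(\lfloor\log_2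 n\rfloor+1)$ (with the convention $\lfloor\log_2 0\rfloor=0$) and every injective coding of the letters of $\Sigma$ by $W$-bit words, the program, started with $n$, $k$, the coded letters of $w_1$ and the coded letters of $w_2$ in consecutive memory cells from address $0$ and with all other cells and all registers equal to $0$, halts after at most $p(n)$ instructions and answers yes if and only if $w_1\equiv_k w_2$. -/

import Mathlib

/-! ### Binomial coefficients of words -/

/-- The binomial coefficient `(u choose v)` of words: the number of occurrences of `v` as a
scattered factor of `u`, i.e. of strictly increasing position sequences of `u` that spell `v`. -/
noncomputable def wordBinom {A : Type*} (u v : List A) : ℕ :=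
  Nat.card {f : Fin v.length ↪o Fin u.length // ∀ j, u.get (f j) = v.get j}

/-- `k`-binomial equivalence of words. -/
def BinomEquiv {A : Type*} (k : ℕ) (u v : List A) : Prop :=
  ∀ x : List A, x.length ≤ k → wordBinom u x = wordBinom v x

/-! ### The unit-cost word RAM -/

namespace WordRAM

/-- Binary arithmetic, bitwise and comparison operations on machine words. -/
inductive BinOp where
  | add | sub | mul | div | mod | shl | shr | and | or | xor | eq | lt

/-- Arithmetic is modulo `2 ^ W`, words are unsigned; `x / 0 = 0` and `x % 0 = x`.
Comparisons return `1` or `0`. -/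
def BinOp.eval {W : ℕ} : BinOp → BitVec W → BitVec W → BitVec W
  | .add, x, y => x + y
  | .sub, x, y => x - y
  | .mul, x, y => x * y
  | .div, x, y => x / y
  | .mod, x, y => x % y
  | .shl, x, y => x <<< y
  | .shr, x, y => x >>> y
  | .and, x, y => x &&& y
  | .or, x, y => x ||| y
  | .xor, x, y => x ^^^ y
  | .eq, x, y => if x = y then 1 else 0
  | .lt, x, y => if x.toNat < y.toNat then 1 else 0

/-- Instructions. Arguments `d`, `s`, `s'`, `a` are names of registers (a program mentions only
finitely many), and `l` is a position in the program. -/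
inductive Instr where
  /-- `R[d] := c` -/
  | const (d : ℕ) (c : ℕ)
  /-- `R[d] := R[s]` -/
  | move (d s : ℕ)
  /-- `R[d] := R[s] op R[s']` -/
  | bin (op : BinOp) (d s s' : ℕ)
  /-- `R[d] :=` bitwise complement of `R[s]` -/
  | compl (d s : ℕ)
  /-- `R[d] := M[R[a]]` -/
  | load (d a : ℕ)
  /-- `M[R[a]] := R[s]` -/
  | store (a s : ℕ)
  /-- unconditional branch -/
  | jump (l : ℕ)
  /-- branch if `R[s] = 0` -/
  | jumpZero (s : ℕ) (l : ℕ)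
  /-- subroutine call: put the return position into `R[d]` and branch to `l` -/
  | call (d : ℕ) (l : ℕ)
  /-- subroutine return: branch to the position stored in `R[s]` -/
  | ret (s : ℕ)
  /-- stop with the answer yes (`true`) or no (`false`) -/
  | halt (answer : Bool)

/-- A program is a finite list of instructions. It does not depend on the word size. -/
abbrev Program := List Instr

/-- A configuration of a machine with word size `W`: the program counter, the registers, and a
memory of `2 ^ W` cells; every register and every cell holds one `W`-bit word. -/
structure Config (W : ℕ) where
  pc : ℕ
  reg : ℕ → BitVec W
  mem : BitVec W → BitVec W

/-- Write `v` into register `d` and proceed to the next instruction. -/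
def Config.setReg {W : ℕ} (s : Config W) (d : ℕ) (v : BitVec W) : Config W :=
  { s with pc := s.pc + 1, reg := Function.update s.reg d v }

/-- Effect of one instruction; `none` if it is a `halt`. -/
def Instr.exec {W : ℕ} (s : Config W) : Instr → Option (Config W)
  | .const d c => some (s.setReg d (BitVec.ofNat W c))
  | .move d r => some (s.setReg d (s.reg r))
  | .bin op d r r' => some (s.setReg d (op.eval (s.reg r) (s.reg r')))
  | .compl d r => some (s.setReg d (~~~(s.reg r)))
  | .load d a => some (s.setReg d (s.mem (s.reg a)))
  | .store a r =>
      some { s with pc := s.pc + 1, mem := Function.update s.mem (s.reg a) (s.reg r) }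
  | .jump l => some { s with pc := l }
  | .jumpZero r l => some { s with pc := if s.reg r = 0 then l else s.pc + 1 }
  | .call d l => some { s.setReg d (BitVec.ofNat W (s.pc + 1)) with pc := l }
  | .ret r => some { s with pc := (s.reg r).toNat }
  | .halt _ => none

/-- One step of program `P`; `none` if the machine has halted or the program counter has left
the program. -/
def step {W : ℕ} (P : Program) (s : Config W) : Option (Config W) :=
  P[s.pc]?.bind (Instr.exec s)

/-- `HaltsIn P s t b`: started in configuration `s`, program `P` executes exactly `t`
instructions, the last of which is `halt b`. -/
inductive HaltsIn {W : ℕ} (P : Program) : Config W → ℕ → Bool → Prop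
  | halt {s : Config W} {b : Bool} : P[s.pc]? = some (.halt b) → HaltsIn P s 1 b
  | step {s s' : Config W} {t : ℕ} {b : Bool} :
      step P s = some s' → HaltsIn P s' t b → HaltsIn P s (t + 1) b

/-- The initial configuration on an array of machine words: the array occupies the cells
`0, 1, 2, …`; all other cells and all registers are `0`. -/
def initial {W : ℕ} (input : List (BitVec W)) : Config W where
  pc := 0
  reg := fun _ => 0
  mem := fun a => input.getD a.toNat 0

end WordRAM

/-- The input array for two words `w₁`, `w₂` and a number `k`: first the length `|w₁|`, then `k`,
then the letters of `w₁` and then those of `w₂`, one machine word per letter. -/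
def binomInput {A : Type*} {W : ℕ} (code : A → BitVec W) (k : ℕ) (w₁ w₂ : List A) :
    List (BitVec W) :=
  BitVec.ofNat W w₁.length :: BitVec.ofNat W k :: (w₁.map code ++ w₂.map code)

/-! ### Counting pairs of equal scattered factors -/

/-! Write S(a,b) for the sum, over all words x of length at most k, of the product of the
coefficients of x in w_a and in w_b. The words are equivalent iff the sum of squared differences,
S(1,1) + S(2,2) - S(1,2) - S(2,1), is zero. Although the sum runs over exponentially many x, S(a,b)
counts pairs of position sequences that spell the same word. Splitting off the last pair of
positions gives the recursion `matchSum`, hence a dynamic program over length bound and two prefix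
lengths (`matchSum_letterMatch`, `binomEquiv_iff_matchSum`).

These counts can reach about 4^n and do not fit into a machine word, so the table is computed modulo
every M ≤ 4(n+2). A nonzero number divisible by all these M is a multiple of the central binomial
coefficient of 2(n+2), which exceeds 2·4^n, a bound on the absolute difference; hence agreement for
all M means equality (`eq_zero_of_forall_dvd`).

The RAM program stores all moduli, word pairs, length bounds and prefix lengths in one array indexed
by mixed radix digits. One flat loop adds a single term of a single cell per round
(`fillCode_spec`), and a second loop compares final cells modulus by modulus (`compareCode_spec`).
-/

/-- `matchSum e m i j` is the `e`-weighted number of pairs of equally long increasing sequences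
of fewer than `m` positions below `i` and below `j`. -/
def matchSum (e : ℕ → ℕ → ℕ) : ℕ → ℕ → ℕ → ℕ
  | 0, _, _ => 0
  | m + 1, i, j => 1 + ∑ i' ∈ Finset.range i, ∑ j' ∈ Finset.range j, e i' j' * matchSum e m i' j'

theorem matchSum_congr {e e' : ℕ → ℕ → ℕ} {n : ℕ}
    (h : ∀ i < n, ∀ j < n, e i j = e' i j) (m : ℕ) :
    ∀ i ≤ n, ∀ j ≤ n, matchSum e m i j = matchSum e' m i j := by
  induction m with
  | zero => intros; rfl
  | succ m ih =>
    intro i hi j hj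
    simp only [matchSum]
    congr 1
    refine Finset.sum_congr rfl fun i' hi' => Finset.sum_congr rfl fun j' hj' => ?_
    rw [Finset.mem_range] at hi' hj'
    rw [h i' (by omega) j' (by omega), ih i' (by omega) j' (by omega)]

/-- There are at most 2^i · 2^j pairs of position sets; in the recursion the two geometric sums give
(2^i - 1)(2^j - 1) + 1. -/
theorem matchSum_le {e : ℕ → ℕ → ℕ} (he : ∀ i j, e i j ≤ 1) (m : ℕ) :
    ∀ i j, matchSum e m i j ≤ 2 ^ i * 2 ^ j := by
  induction m with
  | zero => intros; exact Nat.zero_le _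
  | succ m ih =>
    intro i j
    have h1 : ∑ i' ∈ Finset.range i, ∑ j' ∈ Finset.range j, e i' j' * matchSum e m i' j'
        ≤ ∑ i' ∈ Finset.range i, ∑ j' ∈ Finset.range j, 2 ^ i' * 2 ^ j' :=
      Finset.sum_le_sum fun i' _ => Finset.sum_le_sum fun j' _ =>
        (Nat.mul_le_mul (he i' j') (ih i' j')).trans (by simp)
    rw [← Finset.sum_mul_sum, Nat.geomSum_eq le_rfl, Nat.geomSum_eq le_rfl] at h1
    simp only [matchSum]
    obtain ⟨a, ha⟩ := Nat.exists_eq_add_of_le (Nat.one_le_two_pow (n := i))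
    obtain ⟨b, hb⟩ := Nat.exists_eq_add_of_le (Nat.one_le_two_pow (n := j))
    rw [ha, hb] at h1 ⊢
    simp at h1
    nlinarith

/-! ### Scattered factors and inner products of their counts -/

section Occurrences

variable {A : Type*}

/-- The increasing position sequences below `i` at which `u` spells `x`. -/
def Occ (u : ℕ → A) (i : ℕ) {m : ℕ} (x : Fin m → A) : Type :=
  {f : Fin m → ℕ // StrictMono f ∧ (∀ j, f j < i) ∧ ∀ j, u (f j) = x j}

instance (u : ℕ → A) (i : ℕ) {m : ℕ} (x : Fin m → A) : Finite (Occ u i x) :=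
  Finite.of_injective (β := Fin m → Fin i) (fun f j => ⟨f.1 j, f.2.2.1 j⟩) fun f g h => by
    apply Subtype.ext
    funext j
    simpa using congrFun h j

/-- Removal of the last position of an occurrence. -/
def occSuccEquiv (u : ℕ → A) (i : ℕ) {m : ℕ} (x : Fin m → A) (b : A) :
    Occ u i (Fin.snoc x b : Fin (m + 1) → A) ≃
      Σ i' : {i' : Fin i // u i' = b}, Occ u i'.1 x where
  toFun f := ⟨⟨⟨f.1 (Fin.last m), f.2.2.1 _⟩, by simpa using f.2.2.2 (Fin.last m)⟩,
    ⟨fun j => f.1 j.castSucc, fun a b h => f.2.1 (Fin.castSucc_lt_castSucc_iff.2 h),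
      fun j => f.2.1 (Fin.castSucc_lt_last j), fun j => by simpa using f.2.2.2 j.castSucc⟩⟩
  invFun g := ⟨(Fin.snoc g.2.1 (g.1.1 : ℕ) : Fin (m + 1) → ℕ), by
    refine ⟨?_, ?_, ?_⟩
    · intro a b h
      induction b using Fin.lastCases with
      | last =>
        induction a using Fin.lastCases with
        | last => exact absurd h (lt_irrefl _)
        | cast a => simpa using g.2.2.2.1 a
      | cast b =>
        induction a using Fin.lastCases with
        | last => exact absurd h (not_lt.2 (Fin.le_last _))
        | cast a => simpa using g.2.2.1 (Fin.castSucc_lt_castSucc_iff.1 h)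
    · intro j
      induction j using Fin.lastCases with
      | last => simp
      | cast j => simpa using (g.2.2.2.1 j).trans g.1.1.2
    · intro j
      induction j using Fin.lastCases with
      | last => simpa using g.1.2
      | cast j => simpa using g.2.2.2.2 j⟩
  left_inv f := by
    apply Subtype.ext
    funext j
    induction j using Fin.lastCases with
    | last => simp
    | cast j => simp
  right_inv := by
    -- The type of the second component depends on the first, so only the underlying numbers and
    -- functions are compared.
    have ext : ∀ p q : Σ i' : {i' : Fin i // u i' = b}, Occ u i'.1 x,
        (p.1.1 : ℕ) = q.1.1 → p.2.1 = q.2.1 → p = q := by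
      rintro ⟨⟨⟨a, _⟩, _⟩, ⟨f, _⟩⟩ ⟨⟨⟨b, _⟩, _⟩, ⟨g, _⟩⟩ h1 h2
      cases h1
      cases h2
      rfl
    exact fun g => ext _ _ (by simp) (by funext j; simp)

open Classical in
theorem card_occ_snoc (u : ℕ → A) (i : ℕ) {m : ℕ} (x : Fin m → A) (b : A) :
    Nat.card (Occ u i (Fin.snoc x b : Fin (m + 1) → A)) =
      ∑ i' ∈ Finset.range i, if u i' = b then Nat.card (Occ u i' x) else 0 := by
  rw [Nat.card_congr (occSuccEquiv u i x b), Nat.card_sigma,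
    Finset.sum_range (fun i' => if u i' = b then Nat.card (Occ u i' x) else 0),
    ← Finset.sum_filter]
  exact (Finset.sum_subtype (Finset.univ.filter fun i' : Fin i => u i' = b) (by simp)
    (fun i' : Fin i => Nat.card (Occ u i' x))).symm

open Classical in
/-- The indicator of equal letters. -/
noncomputable def letterMatch (u v : ℕ → A) (i j : ℕ) : ℕ := if u i = v j then 1 else 0

/-- Split off the last letter b of x, placed at i' in u and at j' in v. Summing over b merges the
conditions u i' = b and v j' = b into u i' = v j', so the alphabet disappears. -/
theorem sum_card_occ_mul_succ [Fintype A] (u v : ℕ → A) (i j m : ℕ) :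
    ∑ x : Fin (m + 1) → A, Nat.card (Occ u i x) * Nat.card (Occ v j x) =
      ∑ i' ∈ Finset.range i, ∑ j' ∈ Finset.range j, letterMatch u v i' j' *
        ∑ x : Fin m → A, Nat.card (Occ u i' x) * Nat.card (Occ v j' x) := by
  classical
  rw [← (Fin.snocEquiv fun _ => A).sum_comp, Fintype.sum_prod_type]
  have h : ∀ (b : A) (x : Fin m → A), (Fin.snocEquiv fun _ => A) (b, x) =
    (Fin.snoc x b : Fin (m + 1) → A) := fun _ _ => rfl
  have hcomm : ∀ F : A → (Fin m → A) → ℕ → ℕ → ℕ,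
      ∑ b, ∑ x, ∑ i' ∈ Finset.range i, ∑ j' ∈ Finset.range j, F b x i' j' =
        ∑ i' ∈ Finset.range i, ∑ j' ∈ Finset.range j, ∑ x, ∑ b, F b x i' j' := by
    intro F
    calc _ = ∑ b, ∑ i' ∈ Finset.range i, ∑ x, ∑ j' ∈ Finset.range j, F b x i' j' :=
          Finset.sum_congr rfl fun _ _ => Finset.sum_comm
      _ = ∑ i' ∈ Finset.range i, ∑ b, ∑ x, ∑ j' ∈ Finset.range j, F b x i' j' := Finset.sum_comm
      _ = ∑ i' ∈ Finset.range i, ∑ b, ∑ j' ∈ Finset.range j, ∑ x, F b x i' j' :=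
          Finset.sum_congr rfl fun _ _ => Finset.sum_congr rfl fun _ _ => Finset.sum_comm
      _ = ∑ i' ∈ Finset.range i, ∑ j' ∈ Finset.range j, ∑ b, ∑ x, F b x i' j' :=
          Finset.sum_congr rfl fun _ _ => Finset.sum_comm
      _ = _ := Finset.sum_congr rfl fun _ _ => Finset.sum_congr rfl fun _ _ => Finset.sum_comm
  simp only [h, card_occ_snoc, Finset.sum_mul_sum, hcomm]
  refine Finset.sum_congr rfl fun i' _ => Finset.sum_congr rfl fun j' _ => ?_
  rw [Finset.mul_sum]
  refine Finset.sum_congr rfl fun x _ => ?_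
  simp [letterMatch, ite_mul, eq_comm]

/-- Both sides obey the same recursion; the summand 1 is the empty word. Lengths below k occur here,
which is why k + 1 is used later. -/
theorem matchSum_letterMatch [Fintype A] (u v : ℕ → A) (k : ℕ) :
    ∀ i j, matchSum (letterMatch u v) k i j =
      ∑ m ∈ Finset.range k, ∑ x : Fin m → A, Nat.card (Occ u i x) * Nat.card (Occ v j x) := by
  induction k with
  | zero => intros; rfl
  | succ k ih =>
    intro i j
    have h0 : ∀ (u : ℕ → A) (i : ℕ) (x : Fin 0 → A), Nat.card (Occ u i x) = 1 := by
      intro u i x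
      have : Unique (Occ u i x) :=
        { default := ⟨Fin.elim0, fun a => a.elim0, fun a => a.elim0, fun a => a.elim0⟩
          uniq := fun f => Subtype.ext (Subsingleton.elim _ _) }
      exact Nat.card_unique
    rw [Finset.sum_range_succ', matchSum]
    simp only [h0, sum_card_occ_mul_succ, ih, Finset.mul_sum]
    have hcomm : ∀ F : ℕ → ℕ → ℕ → ℕ,
        ∑ i' ∈ Finset.range i, ∑ j' ∈ Finset.range j, ∑ l ∈ Finset.range k, F i' j' l =
          ∑ l ∈ Finset.range k, ∑ i' ∈ Finset.range i, ∑ j' ∈ Finset.range j, F i' j' l := by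
      intro F
      rw [Finset.sum_comm (s := Finset.range k)]
      exact Finset.sum_congr rfl fun _ _ => Finset.sum_comm
    rw [hcomm, add_comm]
    simp

theorem wordBinom_eq_card_occ (u : List A) (d : A) {m : ℕ} (x : Fin m → A) :
    wordBinom u (List.ofFn x) = Nat.card (Occ (fun l => u.getD l d) u.length x) := by
  -- A general y of length m allows m to be replaced by `y.length`, so that no casts remain.
  have key : ∀ (y : List A) (h : y.length = m), (∀ j : Fin y.length, y.get j = x (Fin.cast h j)) →
      wordBinom u y = Nat.card (Occ (fun l => u.getD l d) u.length x) := by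
    rintro y rfl hy
    refine Nat.card_congr
      { toFun := fun f => ⟨fun j => f.1 j, fun a b h => f.1.strictMono h, fun j => (f.1 j).2,
          fun j => ?_⟩
        invFun := fun f => ⟨OrderEmbedding.ofStrictMono (fun j => ⟨f.1 j, f.2.2.1 j⟩)
          fun a b h => f.2.1 h, fun j => ?_⟩
        left_inv := fun f => ?_
        right_inv := fun f => ?_ }
    · have := f.2 j
      rw [hy j] at this
      simpa using this
    · have := f.2.2.2 j
      rw [hy j]
      have hlt := f.2.2.1 j
      simp only [List.getD_eq_getElem _ _ hlt] at this
      exact this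
    · rfl
    · rfl
  exact key _ (List.length_ofFn) fun j => by simp; rfl

/-- The sum of the squared differences of the binomial coefficients vanishes exactly for
equivalent words. -/
theorem binomEquiv_iff_matchSum [Finite A] (d : A) (k n : ℕ) (w₁ w₂ : List A)
    (h₁ : w₁.length = n) (h₂ : w₂.length = n) :
    BinomEquiv k w₁ w₂ ↔
      (matchSum (letterMatch (w₁.getD · d) (w₁.getD · d)) (k + 1) n n +
        matchSum (letterMatch (w₂.getD · d) (w₂.getD · d)) (k + 1) n n : ℤ) -
      (matchSum (letterMatch (w₁.getD · d) (w₂.getD · d)) (k + 1) n n +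
        matchSum (letterMatch (w₂.getD · d) (w₁.getD · d)) (k + 1) n n) = 0 := by
  have := Fintype.ofFinite A
  simp only [matchSum_letterMatch]
  push_cast
  simp only [← Finset.sum_add_distrib, ← Finset.sum_sub_distrib]
  have hsq : ∀ a b : ℤ, a * a + b * b - (a * b + b * a) = (a - b) ^ 2 := by intros; ring
  simp only [hsq]
  rw [Finset.sum_eq_zero_iff_of_nonneg fun m _ => Finset.sum_nonneg fun x _ => sq_nonneg _]
  have hw₁ := fun (m : ℕ) (x : Fin m → A) => wordBinom_eq_card_occ w₁ d x
  have hw₂ := fun (m : ℕ) (x : Fin m → A) => wordBinom_eq_card_occ w₂ d x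
  rw [h₁] at hw₁
  rw [h₂] at hw₂
  constructor
  · intro h m hm
    refine Finset.sum_eq_zero fun x _ => ?_
    rw [← hw₁, ← hw₂, h (List.ofFn x) (by simp at hm ⊢; omega)]
    simp
  · intro h x hx
    have h' := h x.length (by simp; omega)
    rw [Finset.sum_eq_zero_iff_of_nonneg fun x _ => sq_nonneg _] at h'
    have h'' := h' x.get (Finset.mem_univ _)
    rw [← hw₁, ← hw₂, List.ofFn_get] at h''
    have := pow_eq_zero_iff (two_ne_zero) |>.1 h''
    omega

end Occurrences

/-! ### Numbers divisible by all small moduli -/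

/-- A number divisible by all of `1, …, 2 m` is divisible by the central binomial coefficient. -/
theorem centralBinom_dvd {m D : ℕ} (h : ∀ M, 0 < M → M ≤ 2 * m → M ∣ D) :
    m.centralBinom ∣ D := by
  rcases eq_or_ne D 0 with rfl | hD
  · exact dvd_zero _
  rcases Nat.eq_zero_or_pos m with rfl | hm
  · simp
  rw [← Nat.factorization_prime_le_iff_dvd (Nat.centralBinom_ne_zero m) hD]
  intro p hp
  rw [← hp.pow_dvd_iff_le_factorization hD]
  -- Every prime power exactly dividing the central binomial coefficient is at most 2m, hence among
  -- the given divisors.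
  refine h _ (pow_pos hp.pos _) ?_
  rw [Nat.centralBinom_eq_two_mul_choose]
  exact Nat.pow_factorization_choose_le (by omega)

/-- With N = 2(n+2), 4^N < N · `centralBinom N`. If D were nonzero, then `centralBinom N` ≤ D ≤
2·4^n, so 256·16^n < 4(n+2)·4^n, contradicting n < 4^n. -/
theorem eq_zero_of_forall_dvd {n D : ℕ} (hD : D ≤ 2 * (2 ^ n * 2 ^ n))
    (h : ∀ M, 0 < M → M ≤ 4 * (n + 2) → M ∣ D) : D = 0 := by
  by_contra h0
  have h1 : (2 * (n + 2)).centralBinom ∣ D := centralBinom_dvd fun M h1 h2 => h M h1 (by omega)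
  have h2 := Nat.le_of_dvd (Nat.pos_of_ne_zero h0) h1
  have h3 := Nat.four_pow_lt_mul_centralBinom (2 * (n + 2)) (by omega)
  have h4 : (4 : ℕ) ^ (2 * (n + 2)) = 256 * (4 ^ n * 4 ^ n) := by
    rw [show 2 * (n + 2) = n + n + 4 by ring, pow_add, pow_add]; ring
  have h5 : (2 : ℕ) ^ n * 2 ^ n = 4 ^ n := by rw [← mul_pow]; norm_num
  have h6 : n < 4 ^ n := Nat.lt_pow_self (by norm_num)
  rw [h5] at hD
  rw [h4] at h3
  have h7 : 2 * (n + 2) * (2 * (n + 2)).centralBinom ≤ 2 * (n + 2) * (2 * 4 ^ n) :=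
    Nat.mul_le_mul_left _ (h2.trans hD)
  nlinarith

namespace WordRAM

/-! ### Symbolic execution -/

/-- Started in `s`, program `P` halts after at most `B` instructions and decides `Q`. -/
def Decides {W : ℕ} (P : Program) (s : Config W) (B : ℕ) (Q : Prop) : Prop :=
  ∃ (t : ℕ) (answer : Bool), HaltsIn P s t answer ∧ t ≤ B ∧ (answer = true ↔ Q)

section

variable {W : ℕ} {P : Program}

theorem Decides.step {s s' : Config W} {B : ℕ} {Q : Prop} (h : Decides P s' B Q)
    (hs : WordRAM.step P s = some s') : Decides P s (B + 1) Q := by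
  obtain ⟨t, b, h1, h2, h3⟩ := h
  exact ⟨t + 1, b, .step hs h1, by omega, h3⟩

theorem Decides.mono {s : Config W} {B B' : ℕ} {Q : Prop} (h : Decides P s B Q) (hB : B ≤ B') :
    Decides P s B' Q := by
  obtain ⟨t, b, h1, h2, h3⟩ := h
  exact ⟨t, b, h1, h2.trans hB, h3⟩

theorem Decides.congr {s : Config W} {B : ℕ} {Q Q' : Prop} (h : Decides P s B Q) (hQ : Q ↔ Q') :
    Decides P s B Q' := by
  obtain ⟨t, b, h1, h2, h3⟩ := h
  exact ⟨t, b, h1, h2, h3.trans hQ⟩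

/-- A loop of at most `T` rounds, each of which reaches a decision or preserves the
invariant `I`. -/
theorem Decides.loop {I : ℕ → Config W → Prop} {Q : Prop} {T b e : ℕ}
    (hstep : ∀ t < T, ∀ s, I t s → Decides P s b Q ∨
      ∃ s', I (t + 1) s' ∧ ∀ B, Decides P s' B Q → Decides P s (B + b) Q)
    (hexit : ∀ s, I T s → Decides P s e Q) {s : Config W} (h : I 0 s) :
    Decides P s (e + T * b) Q := by
  have key : ∀ d ≤ T, ∀ s, I (T - d) s → Decides P s (e + d * b) Q := by
    intro d
    induction d with
    | zero => intro _ s hs; simpa using hexit s hs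
    | succ d ih =>
      intro hd s hs
      rcases hstep (T - (d + 1)) (by omega) s hs with h | ⟨s', h1, h2⟩
      · exact h.mono (by rw [Nat.succ_mul]; omega)
      rw [show T - (d + 1) + 1 = T - d by omega] at h1
      exact (h2 _ (ih (by omega) s' h1)).mono (by ring_nf; rfl)
  exact key T le_rfl s (by simpa using h)

/-! ### Straight-line blocks -/

/-- The register written by an instruction that only computes a register value. -/
def Instr.dest : Instr → ℕ
  | .const d _ | .move d _ | .bin _ d _ _ | .compl d _ | .load d _ => d
  | _ => 0

/-- The registers read by an instruction that only computes a register value. -/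
def Instr.sources : Instr → List ℕ
  | .move _ r | .compl _ r | .load _ r => [r]
  | .bin _ _ r r' => [r, r']
  | _ => []

/-- The value written by an instruction that only computes a register value. -/
def Instr.value (mem : BitVec W → BitVec W) (ρ : ℕ → BitVec W) : Instr → BitVec W
  | .const _ c => BitVec.ofNat W c
  | .move _ r => ρ r
  | .bin op _ r r' => op.eval (ρ r) (ρ r')
  | .compl _ r => ~~~(ρ r)
  | .load _ a => mem (ρ a)
  | _ => 0

/-- The instructions that only compute a register value. -/
def Instr.IsPure : Instr → Bool
  | .const .. | .move .. | .bin .. | .compl .. | .load .. => true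
  | _ => false

/-- The registers after a block of pure instructions. -/
def runBlock (mem : BitVec W → BitVec W) : List Instr → (ℕ → BitVec W) → ℕ → BitVec W
  | [], ρ => ρ
  | i :: l, ρ => runBlock mem l (Function.update ρ i.dest (i.value mem ρ))

/-- Collapses a straight-line stretch of the program into a single `runBlock`. -/
theorem Decides.block {mem : BitVec W → BitVec W} {B : ℕ} {Q : Prop} (l : List Instr) :
    ∀ {pc : ℕ} {ρ : ℕ → BitVec W},
      Decides P ⟨pc + l.length, runBlock mem l ρ, mem⟩ B Q → l <+: P.drop pc →
      l.all Instr.IsPure = true → Decides P ⟨pc, ρ, mem⟩ (B + l.length) Q := by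
  induction l with
  | nil => intro pc ρ h _ _; exact h
  | cons i l ih =>
    intro pc ρ h hP hl
    obtain ⟨r, hr⟩ := hP
    rw [List.all_cons, Bool.and_eq_true] at hl
    have hi : P[pc]? = some i := by
      have := congrArg (fun l => l[0]?) hr
      simpa using this.symm
    have hd : P.drop (pc + 1) = l ++ r := by
      rw [← List.drop_drop, ← hr]; rfl
    have h' : Decides P ⟨pc + 1, Function.update ρ i.dest (i.value mem ρ), mem⟩
        (B + l.length) Q := by
      refine ih ?_ ⟨r, hd.symm⟩ hl.2
      have : pc + (i :: l).length = pc + 1 + l.length := by simp; omega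
      rw [this] at h
      exact h
    refine h'.step ?_
    simp only [WordRAM.step, hi, Option.bind_some]
    cases i <;> first | rfl | exact absurd hl.1 (by simp [Instr.IsPure])

theorem runBlock_of_notMem {mem : BitVec W → BitVec W} {x : ℕ} (l : List Instr) :
    ∀ {ρ : ℕ → BitVec W}, x ∉ l.map Instr.dest → runBlock mem l ρ x = ρ x := by
  induction l with
  | nil => intros; rfl
  | cons i l ih =>
    intro ρ h
    rw [List.map_cons, List.mem_cons, not_or] at h
    rw [runBlock, ih h.2, Function.update_of_ne h.1]

/-- Static single assignment: no register is written after it has been written or read. -/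
def IsSSA : List Instr → Bool
  | [] => true
  | i :: l => decide (i.dest ∉ l.map Instr.dest) &&
      i.sources.all (fun r => decide (r ∉ i.dest :: l.map Instr.dest)) && IsSSA l

theorem Instr.value_congr {mem : BitVec W → BitVec W} {ρ ρ' : ℕ → BitVec W} (i : Instr)
    (h : ∀ r ∈ i.sources, ρ r = ρ' r) : i.value mem ρ = i.value mem ρ' := by
  cases i <;> simp_all [Instr.value, Instr.sources]

/-- In an SSA block every written register satisfies its defining equation at the end. -/
theorem runBlock_dest {mem : BitVec W → BitVec W} (l : List Instr) :
    ∀ {ρ : ℕ → BitVec W}, IsSSA l = true → ∀ i ∈ l,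
      runBlock mem l ρ i.dest = i.value mem (runBlock mem l ρ) := by
  induction l with
  | nil => simp
  | cons i l ih =>
    intro ρ h j hj
    simp only [IsSSA, Bool.and_eq_true, decide_eq_true_eq, List.all_eq_true] at h
    obtain ⟨⟨h1, h2⟩, h3⟩ := h
    rcases List.mem_cons.1 hj with rfl | hj
    -- Later instructions change neither the destination nor the sources of this one, so its
    -- equation survives to the final state.
    · rw [runBlock, runBlock_of_notMem l h1, Function.update_self]
      refine Instr.value_congr j fun r hr => ?_
      have := h2 r hr
      rw [List.mem_cons, not_or] at this
      rw [runBlock_of_notMem l this.2, Function.update_of_ne this.1]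
    · exact ih h3 j hj

end

/-! ### Word arithmetic without overflow -/

section

variable {W : ℕ}

/-- Sums and products commute with reduction modulo 2^W and need no bound, unlike quotients,
remainders and comparisons. -/
theorem eval_add (a b : ℕ) : BinOp.add.eval (BitVec.ofNat W a) (BitVec.ofNat W b) =
    BitVec.ofNat W (a + b) := (BitVec.ofNat_add a b).symm

theorem eval_mul (a b : ℕ) : BinOp.mul.eval (BitVec.ofNat W a) (BitVec.ofNat W b) =
    BitVec.ofNat W (a * b) := (BitVec.ofNat_mul a b).symm

theorem toNat_ofNat_of_lt {a : ℕ} (ha : a < 2 ^ W) : (BitVec.ofNat W a).toNat = a := by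
  rw [BitVec.toNat_ofNat, Nat.mod_eq_of_lt ha]

theorem ofNat_inj {a b : ℕ} (ha : a < 2 ^ W) (hb : b < 2 ^ W) :
    BitVec.ofNat W a = BitVec.ofNat W b ↔ a = b := by
  rw [← BitVec.toNat_inj, toNat_ofNat_of_lt ha, toNat_ofNat_of_lt hb]

theorem eval_div {a b : ℕ} (ha : a < 2 ^ W) (hb : b < 2 ^ W) :
    BinOp.div.eval (BitVec.ofNat W a) (BitVec.ofNat W b) = BitVec.ofNat W (a / b) := by
  apply BitVec.eq_of_toNat_eq
  rw [BinOp.eval, BitVec.toNat_udiv, toNat_ofNat_of_lt ha, toNat_ofNat_of_lt hb,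
    toNat_ofNat_of_lt ((Nat.div_le_self _ _).trans_lt ha)]

theorem eval_mod {a b : ℕ} (ha : a < 2 ^ W) (hb : b < 2 ^ W) :
    BinOp.mod.eval (BitVec.ofNat W a) (BitVec.ofNat W b) = BitVec.ofNat W (a % b) := by
  apply BitVec.eq_of_toNat_eq
  rw [BinOp.eval, BitVec.toNat_umod, toNat_ofNat_of_lt ha, toNat_ofNat_of_lt hb,
    toNat_ofNat_of_lt ((Nat.mod_le _ _).trans_lt ha)]

theorem eval_lt {a b : ℕ} (ha : a < 2 ^ W) (hb : b < 2 ^ W) :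
    BinOp.lt.eval (BitVec.ofNat W a) (BitVec.ofNat W b) =
      BitVec.ofNat W (if a < b then 1 else 0) := by
  rw [BinOp.eval, toNat_ofNat_of_lt ha, toNat_ofNat_of_lt hb]
  split <;> rfl

theorem eval_eq (x y : BitVec W) :
    BinOp.eq.eval x y = BitVec.ofNat W (if x = y then 1 else 0) := by
  rw [BinOp.eval]
  split <;> rfl

end

end WordRAM

/-! ### The table of partial sums -/

theorem sum_range_mul_eq_sum_sum (f : ℕ → ℕ → ℕ) (a b : ℕ) :
    ∑ s ∈ Finset.range (a * b), f (s / b) (s % b) =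
      ∑ i ∈ Finset.range a, ∑ j ∈ Finset.range b, f i j := by
  induction a with
  | zero => simp
  | succ a ih =>
    rw [Nat.succ_mul, Finset.sum_range_add, ih, Finset.sum_range_succ]
    congr 1
    refine Finset.sum_congr rfl fun j hj => ?_
    rw [Finset.mem_range] at hj
    rw [mul_comm a b, Nat.mul_add_div (by omega), Nat.mul_add_mod, Nat.mod_eq_of_lt hj,
      Nat.div_eq_of_lt hj, add_zero]

namespace BinomTable

/-- Cell `c` of the table holds, in the mixed radix digits of `c`, a modulus, two word indices, a
length bound and two prefix lengths. -/
def cellModulus (n k c : ℕ) : ℕ := c / ((n + 1) * (n + 1)) / (k + 2) / 2 / 2 + 1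

/-- The matching predicate of the two words that belong to block `u` of the table. -/
def cellMatch (k : ℕ) (e : ℕ → ℕ → ℕ → ℕ → ℕ) (u : ℕ) : ℕ → ℕ → ℕ :=
  e (u / (k + 2) / 2 % 2) (u / (k + 2) % 2)

/-- The final value of a cell before reduction. -/
def cellValue (n k : ℕ) (e : ℕ → ℕ → ℕ → ℕ → ℕ) (c : ℕ) : ℕ :=
  matchSum (cellMatch k e (c / ((n + 1) * (n + 1)))) (c / ((n + 1) * (n + 1)) % (k + 2))
    (c % ((n + 1) * (n + 1)) / (n + 1)) (c % ((n + 1) * (n + 1)) % (n + 1))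

/-- The contribution to cell `c` of the pair of positions encoded by `s`. -/
def cellTerm (n k : ℕ) (e : ℕ → ℕ → ℕ → ℕ → ℕ) (c s : ℕ) : ℕ :=
  if c / ((n + 1) * (n + 1)) % (k + 2) = 0 then 0 else
    (if s = 0 then 1 else 0) +
    if s / (n + 1) < c % ((n + 1) * (n + 1)) / (n + 1) ∧
        s % (n + 1) < c % ((n + 1) * (n + 1)) % (n + 1) then
      cellMatch k e (c / ((n + 1) * (n + 1))) (s / (n + 1)) (s % (n + 1)) *
        matchSum (cellMatch k e (c / ((n + 1) * (n + 1))))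
          (c / ((n + 1) * (n + 1)) % (k + 2) - 1) (s / (n + 1)) (s % (n + 1))
    else 0

/-- The value of cell `c`, before reduction, after `t` rounds. -/
def cellPartial (n k : ℕ) (e : ℕ → ℕ → ℕ → ℕ → ℕ) (t c : ℕ) : ℕ :=
  ∑ s ∈ Finset.range (min ((n + 1) * (n + 1)) (t - c * ((n + 1) * (n + 1)))), cellTerm n k e c s

/-- The terms run over all (n+1)^2 pairs of positions, and the guard keeps those below the two
prefix lengths. The summand 1 of the recursion is charged to s = 0. -/
theorem sum_cellTerm (n k : ℕ) (e : ℕ → ℕ → ℕ → ℕ → ℕ) (c : ℕ) :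
    ∑ s ∈ Finset.range ((n + 1) * (n + 1)), cellTerm n k e c s = cellValue n k e c := by
  unfold cellTerm cellValue
  have hpos : 0 < (n + 1) * (n + 1) := by positivity
  have hr : c % ((n + 1) * (n + 1)) < (n + 1) * (n + 1) := Nat.mod_lt _ hpos
  have hi : c % ((n + 1) * (n + 1)) / (n + 1) < n + 1 := Nat.div_lt_of_lt_mul hr
  have hj : c % ((n + 1) * (n + 1)) % (n + 1) < n + 1 := Nat.mod_lt _ (by omega)
  generalize c % ((n + 1) * (n + 1)) / (n + 1) = i at *
  generalize c % ((n + 1) * (n + 1)) % (n + 1) = j at *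
  generalize cellMatch k e (c / ((n + 1) * (n + 1))) = f at *
  rcases hm : c / ((n + 1) * (n + 1)) % (k + 2) with _ | m
  · simp [matchSum]
  · simp only [Nat.add_eq_zero_iff, one_ne_zero, and_false, if_false, Finset.sum_add_distrib,
      Nat.add_sub_cancel, matchSum]
    congr 1
    · rw [Finset.sum_ite_eq' (Finset.range ((n + 1) * (n + 1))) 0 (fun _ => 1)]
      simp
    · rw [sum_range_mul_eq_sum_sum
        (fun i' j' => if i' < i ∧ j' < j then f i' j' * matchSum f m i' j' else 0)]
      simp only [ite_and]
      have hsub : ∀ {a b : ℕ}, a < b → ∀ g : ℕ → ℕ,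
          ∑ x ∈ Finset.range b, (if x < a then g x else 0) = ∑ x ∈ Finset.range a, g x := by
        intro a b hab g
        rw [← Finset.sum_filter]
        refine Finset.sum_congr ?_ fun _ _ => rfl
        ext x
        simp only [Finset.mem_filter, Finset.mem_range]
        omega
      rw [← hsub hi]
      refine Finset.sum_congr rfl fun x _ => ?_
      split
      · exact hsub hj _
      · simp

/-- With L = (n+1)^2, cell c is served exactly in the rounds from cL to (c+1)L - 1. -/
theorem cellPartial_eq_cellValue (n k : ℕ) (e : ℕ → ℕ → ℕ → ℕ → ℕ) {t c : ℕ}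
    (h : (c + 1) * ((n + 1) * (n + 1)) ≤ t) : cellPartial n k e t c = cellValue n k e c := by
  rw [cellPartial, min_eq_left, sum_cellTerm]
  rw [Nat.succ_mul] at h
  omega

theorem cellPartial_zero (n k : ℕ) (e : ℕ → ℕ → ℕ → ℕ → ℕ) (c : ℕ) :
    cellPartial n k e 0 c = 0 := by
  simp [cellPartial]

theorem cellPartial_succ_self (n k : ℕ) (e : ℕ → ℕ → ℕ → ℕ → ℕ) (t : ℕ) :
    cellPartial n k e (t + 1) (t / ((n + 1) * (n + 1))) =
      cellPartial n k e t (t / ((n + 1) * (n + 1))) +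
        cellTerm n k e (t / ((n + 1) * (n + 1))) (t % ((n + 1) * (n + 1))) := by
  have hpos : 0 < (n + 1) * (n + 1) := by positivity
  unfold cellPartial
  generalize (n + 1) * (n + 1) = L at *
  have h1 := Nat.mod_lt t hpos
  have h2 := Nat.div_add_mod' t L
  rw [show min L (t + 1 - t / L * L) = t % L + 1 by omega,
    show min L (t - t / L * L) = t % L by omega, Finset.sum_range_succ]

theorem cellPartial_succ_of_ne (n k : ℕ) (e : ℕ → ℕ → ℕ → ℕ → ℕ) {t c : ℕ}
    (h : c ≠ t / ((n + 1) * (n + 1))) : cellPartial n k e (t + 1) c = cellPartial n k e t c := by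
  have hpos : 0 < (n + 1) * (n + 1) := by positivity
  unfold cellPartial
  generalize (n + 1) * (n + 1) = L at *
  have h1 := Nat.mod_lt t hpos
  have h2 := Nat.div_add_mod' t L
  congr 2
  rcases Nat.lt_or_gt_of_ne h with h | h
  · have := Nat.mul_le_mul_right L (Nat.succ_le_of_lt h)
    rw [Nat.succ_mul] at this
    omega
  · have := Nat.mul_le_mul_right L (Nat.succ_le_of_lt h)
    rw [Nat.succ_mul] at this
    omega

theorem div_mul_add {a b c : ℕ} (h : c < b) : (a * b + c) / b = a := by
  rw [mul_comm, Nat.mul_add_div (by omega), Nat.div_eq_of_lt h, add_zero]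

theorem mod_mul_add {a b c : ℕ} (h : c < b) : (a * b + c) % b = c := by
  rw [mul_comm, Nat.mul_add_mod, Nat.mod_eq_of_lt h]

/-- For d = k + 2: unless the length bound of a block is 0, the preceding block has the same modulus
and words and a length bound smaller by one. -/
theorem div_mod_of_succ {u d : ℕ} (h : (u + 1) % d ≠ 0) :
    u / d = (u + 1) / d ∧ u % d = (u + 1) % d - 1 := by
  rcases Nat.eq_zero_or_pos d with rfl | hd
  · simp
  have h1 := Nat.div_add_mod' (u + 1) d
  have h2 := Nat.mod_lt (u + 1) hd
  have h3 : u = (u + 1) / d * d + ((u + 1) % d - 1) := by omega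
  have h4 : (u + 1) % d - 1 < d := by omega
  constructor
  · conv_lhs => rw [h3, div_mul_add h4]
  · conv_lhs => rw [h3, mod_mul_add h4]

/-- The cell read in order to compute `cellTerm` belongs to the preceding block. -/
theorem cellValue_pred (n k : ℕ) (e : ℕ → ℕ → ℕ → ℕ → ℕ) {u s : ℕ}
    (hs : s < (n + 1) * (n + 1)) (hu : (u + 1) % (k + 2) ≠ 0) :
    cellValue n k e (u * ((n + 1) * (n + 1)) + s) =
      matchSum (cellMatch k e (u + 1)) ((u + 1) % (k + 2) - 1) (s / (n + 1)) (s % (n + 1)) := by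
  obtain ⟨h1, h2⟩ := div_mod_of_succ hu
  rw [cellValue, div_mul_add hs, mod_mul_add hs, h2, cellMatch, cellMatch, h1]

/-- The last cell of the blocks of modulus `h + 1` and words `a` and `b`. -/
theorem cellValue_last (n k : ℕ) (e : ℕ → ℕ → ℕ → ℕ → ℕ) {h a b c : ℕ} (ha : a < 2) (hb : b < 2)
    (hc : c + 1 = (4 * h + 2 * a + b + 1) * ((k + 2) * ((n + 1) * (n + 1)))) :
    cellValue n k e c = matchSum (e a b) (k + 1) n n ∧ cellModulus n k c = h + 1 := by
  have hpos : 0 < (n + 1) * (n + 1) := by positivity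
  have hL : n * (n + 1) + n + 1 = (n + 1) * (n + 1) := by ring
  -- The last cell of the block group has length bound k + 1 and both prefix lengths n.
  have h1 : c = ((4 * h + 2 * a + b) * (k + 2) + (k + 1)) * ((n + 1) * (n + 1)) +
      (n * (n + 1) + n) := by
    have : ((4 * h + 2 * a + b) * (k + 2) + (k + 1)) * ((n + 1) * (n + 1)) +
      (n * (n + 1) + n + 1) = (4 * h + 2 * a + b + 1) * ((k + 2) * ((n + 1) * (n + 1))) := by
      ring
    omega
  have h2 : n * (n + 1) + n < (n + 1) * (n + 1) := by omega
  have h3 : (4 * h + 2 * a + b) / 2 / 2 = h := by omega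
  have h4 : (4 * h + 2 * a + b) / 2 % 2 = a := by omega
  have h5 : (4 * h + 2 * a + b) % 2 = b := by omega
  rw [cellValue, cellModulus, cellMatch, h1, div_mul_add h2, mod_mul_add h2,
    div_mul_add (by omega), mod_mul_add (by omega), div_mul_add (by omega),
    mod_mul_add (by omega), h3, h4, h5]
  exact ⟨rfl, rfl⟩

end BinomTable

namespace BinomTable

open WordRAM

/-! ### The program -/

/-- Loads `n` and `k` and computes the parameters of the table. -/
def setupCode : List Instr :=
  [.load 1 0, .const 2 1, .load 3 2, .const 4 2, .bin .add 5 3 4, .bin .add 6 1 2, .bin .mul 7 6 6,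
    .bin .mul 8 1 4, .bin .add 9 8 4, .bin .add 10 9 7, .const 12 4, .bin .add 11 1 4,
    .bin .mul 13 11 12, .bin .mul 14 5 7, .bin .mul 15 13 12, .bin .mul 16 15 14,
    .bin .mul 17 16 7, .bin .add 61 8 2, .bin .add 62 61 7]

/-- Decodes the round number in register `18` and computes the address of a cell (register `57`)
and its new value (register `60`). -/
def fillCode : List Instr :=
  [.bin .mod 20 18 7, .bin .div 21 18 7, .bin .mod 22 21 7, .bin .div 23 21 7,
    .bin .div 24 20 6, .bin .mod 25 20 6, .bin .div 26 22 6, .bin .mod 27 22 6,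
    .bin .mod 28 23 5, .bin .div 29 23 5, .bin .mod 30 29 4, .bin .div 31 29 4,
    .bin .mod 32 31 4, .bin .div 33 31 4, .bin .add 34 33 2,
    .bin .mul 35 32 1, .bin .add 36 35 24, .bin .add 37 36 4, .load 38 37,
    .bin .mul 39 30 1, .bin .add 40 39 25, .bin .add 41 40 4, .load 42 41,
    .bin .eq 43 38 42, .bin .lt 44 24 26, .bin .lt 45 25 27, .bin .mul 46 43 44,
    .bin .mul 47 46 45, .bin .mul 48 23 7, .bin .add 49 48 20, .bin .add 50 49 9, .load 51 50,
    .bin .mul 52 47 51, .bin .eq 53 20 0, .bin .add 54 52 53, .bin .lt 55 0 28,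
    .bin .mul 56 54 55, .bin .add 57 21 10, .load 58 57, .bin .add 59 58 56, .bin .mod 60 59 34]

/-- Loads the final cells of one modulus and compares (register `78`). -/
def compareCode : List Instr :=
  [.bin .add 65 63 2, .bin .add 66 62 14, .load 67 66, .bin .add 68 66 14, .load 69 68,
    .bin .add 70 68 14, .load 71 70, .bin .add 72 70 14, .load 73 72, .bin .add 74 67 73,
    .bin .add 75 69 71, .bin .mod 76 74 65, .bin .mod 77 75 65, .bin .eq 78 76 77]

/-- The program: after the setup, one loop fills the table, and a second loop compares the final
cells for every modulus. -/
def program : Program :=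
  setupCode ++ [.bin .lt 19 18 17, .jumpZero 19 65] ++ fillCode ++
    [.store 57 60, .bin .add 18 18 2, .jump 19, .bin .lt 64 63 13, .jumpZero 64 85] ++
    compareCode ++ [.jumpZero 78 86, .move 63 65, .move 62 72, .jump 65, .halt true, .halt false]

/-- The number of rounds of the first loop. -/
def rounds (n k : ℕ) : ℕ :=
  (n + 2) * 4 * 4 * ((k + 2) * ((n + 1) * (n + 1))) * ((n + 1) * (n + 1))

/-! ### Correctness of the table-filling round -/

section

variable {W : ℕ}

/-- The parameters are in place. -/
structure Params (n k : ℕ) (ρ : ℕ → BitVec W) : Prop where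
  r0 : ρ 0 = BitVec.ofNat W 0
  r1 : ρ 1 = BitVec.ofNat W n
  r2 : ρ 2 = BitVec.ofNat W 1
  r4 : ρ 4 = BitVec.ofNat W 2
  r5 : ρ 5 = BitVec.ofNat W (k + 2)
  r6 : ρ 6 = BitVec.ofNat W (n + 1)
  r7 : ρ 7 = BitVec.ofNat W ((n + 1) * (n + 1))
  r9 : ρ 9 = BitVec.ofNat W (n * 2 + 2)
  r10 : ρ 10 = BitVec.ofNat W (n * 2 + 2 + (n + 1) * (n + 1))
  r13 : ρ 13 = BitVec.ofNat W ((n + 2) * 4)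
  r14 : ρ 14 = BitVec.ofNat W ((k + 2) * ((n + 1) * (n + 1)))
  r17 : ρ 17 = BitVec.ofNat W (rounds n k)

theorem Params.congr {n k : ℕ} {ρ ρ' : ℕ → BitVec W} (h : Params n k ρ)
    (h' : ∀ r < 18, ρ' r = ρ r) : Params n k ρ' := by
  constructor <;> rw [h' _ (by norm_num)]
  exacts [h.r0, h.r1, h.r2, h.r4, h.r5, h.r6, h.r7, h.r9, h.r10, h.r13, h.r14, h.r17]

/-- Equality of letters as seen by the program in the initial memory. -/
def memMatch (μ : BitVec W → BitVec W) (n a b i j : ℕ) : ℕ :=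
  if μ (BitVec.ofNat W (a * n + i + 2)) = μ (BitVec.ofNat W (b * n + j + 2)) then 1 else 0

/-- The memory after `t` rounds of the first loop. -/
structure TableMem (μ : BitVec W → BitVec W) (n k t : ℕ) (mem : BitVec W → BitVec W) : Prop where
  input : ∀ x < n * 2 + 2 + (n + 1) * (n + 1), mem (BitVec.ofNat W x) = μ (BitVec.ofNat W x)
  cell : ∀ c, c + (n * 2 + 2 + (n + 1) * (n + 1)) < 2 ^ W →
    mem (BitVec.ofNat W (c + (n * 2 + 2 + (n + 1) * (n + 1)))) =
      BitVec.ofNat W (cellPartial n k (memMatch μ n) t c % cellModulus n k c)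

/-- A round writes only the cell t / (n+1)^2; without address overflow no other cell is affected. -/
theorem TableMem.succ {μ mem : BitVec W → BitVec W} {n k t v : ℕ} (h : TableMem μ n k t mem)
    (ht : t + (n * 2 + 2 + (n + 1) * (n + 1)) < 2 ^ W)
    (hv : v = cellPartial n k (memMatch μ n) (t + 1) (t / ((n + 1) * (n + 1))) %
      cellModulus n k (t / ((n + 1) * (n + 1)))) :
    TableMem μ n k (t + 1) (Function.update mem
      (BitVec.ofNat W (t / ((n + 1) * (n + 1)) + (n * 2 + 2 + (n + 1) * (n + 1))))
      (BitVec.ofNat W v)) := by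
  have hc : t / ((n + 1) * (n + 1)) ≤ t := Nat.div_le_self _ _
  have hne := fun c => cellPartial_succ_of_ne n k (memMatch μ n) (t := t) (c := c)
  generalize t / ((n + 1) * (n + 1)) = c₀ at *
  constructor
  · intro x hx
    rw [Function.update_of_ne, h.input x hx]
    rw [Ne, ofNat_inj (by omega) (by omega)]
    omega
  · intro c hc'
    by_cases hcc : c = c₀
    · subst hcc
      rw [Function.update_self, hv]
    · rw [Function.update_of_ne, h.cell c hc', hne c hcc]
      rw [Ne, ofNat_inj (by omega) (by omega)]
      omega

/-- The value computed by one round of the first loop. -/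
theorem fillCode_spec {μ mem : BitVec W → BitVec W} {ρ : ℕ → BitVec W} {n k t : ℕ} (hk : k ≤ n)
    (hW : rounds n k + (n * 2 + 2 + (n + 1) * (n + 1)) < 2 ^ W) (ht : t < rounds n k)
    (hρ : Params n k ρ) (h18 : ρ 18 = BitVec.ofNat W t) (hmem : TableMem μ n k t mem) :
    runBlock mem fillCode ρ 57 =
      BitVec.ofNat W (t / ((n + 1) * (n + 1)) + (n * 2 + 2 + (n + 1) * (n + 1))) ∧
    runBlock mem fillCode ρ 60 =
      BitVec.ofNat W (cellPartial n k (memMatch μ n) (t + 1) (t / ((n + 1) * (n + 1))) %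
        cellModulus n k (t / ((n + 1) * (n + 1)))) := by
  have E := runBlock_dest (mem := mem) fillCode (ρ := ρ) (by decide)
  have F : ∀ r < 19, runBlock mem fillCode ρ r = ρ r := fun r hr =>
    runBlock_of_notMem _ (by
      intro hmem
      have : ∀ x ∈ fillCode.map Instr.dest, 19 ≤ x := by decide
      exact absurd (this r hmem) (by omega))
  have hρ' : Params n k (runBlock mem fillCode ρ) := hρ.congr fun r hr => F r (by omega)
  have h18' := (F 18 (by norm_num)).trans h18
  generalize runBlock mem fillCode ρ = σ at *
  simp only [fillCode, List.forall_mem_cons, Instr.dest, Instr.value] at E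
  obtain ⟨e20, e21, e22, e23, e24, e25, e26, e27, e28, e29, e30, e31, e32, e33, e34, e35, e36, e37,
    e38, e39, e40, e41, e42, e43, e44, e45, e46, e47, e48, e49, e50, e51, e52, e53, e54, e55, e56,
    e57, e58, e59, e60, -⟩ := E
  have hKpos : 0 < n + 1 := by omega
  have hK : n + 1 < 2 ^ W := by omega
  have hLpos : 0 < (n + 1) * (n + 1) := by positivity
  have hL : (n + 1) * (n + 1) < 2 ^ W := by omega
  have hT : t < 2 ^ W := by omega
  have hk2 : k + 2 < 2 ^ W := by omega
  have h2 : 2 < 2 ^ W := by omega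
  have hsL := Nat.mod_lt t hLpos
  have hst := Nat.mod_le t ((n + 1) * (n + 1))
  have hct := Nat.div_le_self t ((n + 1) * (n + 1))
  have htcs := Nat.div_add_mod' t ((n + 1) * (n + 1))
  have hold := hmem.cell (t / ((n + 1) * (n + 1))) (by omega)
  rw [cellPartial_succ_self]
  rw [h18', hρ'.r7, eval_mod hT hL] at e20
  rw [h18', hρ'.r7, eval_div hT hL] at e21
  rw [e21, hρ'.r10, eval_add] at e57
  rw [e57, hold] at e58
  refine ⟨e57, ?_⟩
  unfold cellTerm cellMatch cellModulus at *
  generalize t / ((n + 1) * (n + 1)) = c at *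
  generalize t % ((n + 1) * (n + 1)) = s at *
  have hcW : c < 2 ^ W := by omega
  have hsW : s < 2 ^ W := by omega
  rw [e21, hρ'.r7, eval_mod hcW hL] at e22
  rw [e21, hρ'.r7, eval_div hcW hL] at e23
  rw [e20, hρ'.r6, eval_div hsW hK] at e24
  rw [e20, hρ'.r6, eval_mod hsW hK] at e25
  have hrW : c % ((n + 1) * (n + 1)) < 2 ^ W := (Nat.mod_le _ _).trans_lt hcW
  have huc : c / ((n + 1) * (n + 1)) ≤ c := Nat.div_le_self _ _
  have hcur := Nat.div_add_mod' c ((n + 1) * (n + 1))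
  have hiK : s / (n + 1) < n + 1 := Nat.div_lt_of_lt_mul hsL
  have hjK : s % (n + 1) < n + 1 := Nat.mod_lt _ hKpos
  rw [e22, hρ'.r6, eval_div hrW hK] at e26
  rw [e22, hρ'.r6, eval_mod hrW hK] at e27
  have hiW : c % ((n + 1) * (n + 1)) / (n + 1) < 2 ^ W := (Nat.div_le_self _ _).trans_lt hrW
  have hjW : c % ((n + 1) * (n + 1)) % (n + 1) < 2 ^ W := (Nat.mod_le _ _).trans_lt hrW
  -- The table starts one block length after 2n + 2, so this address is slot s of the preceding
  -- block, whose cells are already complete. The gap keeps the address valid for block 0 too, where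
  -- the loaded value is irrelevant.
  have hpred : c / ((n + 1) * (n + 1)) % (k + 2) ≠ 0 →
      mem (BitVec.ofNat W (c / ((n + 1) * (n + 1)) * ((n + 1) * (n + 1)) + s + (n * 2 + 2))) =
        BitVec.ofNat W (matchSum (cellMatch k (memMatch μ n) (c / ((n + 1) * (n + 1))))
          (c / ((n + 1) * (n + 1)) % (k + 2) - 1) (s / (n + 1)) (s % (n + 1)) %
            (c / ((n + 1) * (n + 1)) / (k + 2) / 2 / 2 + 1)) := by
    intro hm
    obtain ⟨u, hu⟩ : ∃ u, c / ((n + 1) * (n + 1)) = u + 1 :=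
      Nat.exists_eq_succ_of_ne_zero fun h => hm (by rw [h, Nat.zero_mod])
    rw [hu] at hcur huc hm ⊢
    rw [Nat.succ_mul] at hcur
    have h1 := hmem.cell (u * ((n + 1) * (n + 1)) + s) (by omega)
    rw [cellPartial_eq_cellValue, cellValue_pred _ _ _ hsL hm, cellModulus, div_mul_add hsL,
      (div_mod_of_succ hm).1] at h1
    · rw [← h1]
      congr 2
      ring
    · have : u * ((n + 1) * (n + 1)) + s + 1 ≤ c := by omega
      have := Nat.mul_le_mul_right ((n + 1) * (n + 1)) this
      omega
  unfold cellMatch at hpred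
  generalize c % ((n + 1) * (n + 1)) / (n + 1) = i at *
  generalize c % ((n + 1) * (n + 1)) % (n + 1) = j at *
  generalize cellPartial n k (memMatch μ n) t c = p at *
  have huW : c / ((n + 1) * (n + 1)) < 2 ^ W := by omega
  rw [e23, hρ'.r7, eval_mul] at e48
  rw [e48, e20, eval_add] at e49
  rw [e49, hρ'.r9, eval_add] at e50
  rw [e50] at e51
  rw [e23, hρ'.r5, eval_mod huW hk2] at e28
  rw [e23, hρ'.r5, eval_div huW hk2] at e29
  have huT : c / ((n + 1) * (n + 1)) ≤ t := by omega
  generalize c / ((n + 1) * (n + 1)) = u at *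
  have hhu := Nat.div_le_self u (k + 2)
  have hhW : u / (k + 2) < 2 ^ W := by omega
  have hmW : u % (k + 2) < 2 ^ W := (Nat.mod_le _ _).trans_lt huW
  generalize u / (k + 2) = h at *
  generalize u % (k + 2) = m at *
  rw [e29, hρ'.r4, eval_mod hhW h2] at e30
  rw [e29, hρ'.r4, eval_div hhW h2] at e31
  rw [e31, hρ'.r4, eval_mod (by omega) h2] at e32
  rw [e31, hρ'.r4, eval_div (by omega) h2] at e33
  rw [e33, hρ'.r2, eval_add] at e34
  have ha : h / 2 % 2 < 2 := Nat.mod_lt _ (by norm_num)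
  have hb : h % 2 < 2 := Nat.mod_lt _ (by norm_num)
  have hM : 2 * (h / 2 / 2 + 1) < 2 ^ W := by omega
  have hMpos : 0 < h / 2 / 2 + 1 := by omega
  generalize h / 2 % 2 = a at *
  generalize h % 2 = b at *
  have han : a * n ≤ n := (Nat.mul_le_mul_right n (Nat.lt_succ_iff.1 ha)).trans (by omega)
  have hbn : b * n ≤ n := (Nat.mul_le_mul_right n (Nat.lt_succ_iff.1 hb)).trans (by omega)
  rw [e32, hρ'.r1, eval_mul] at e35
  rw [e35, e24, eval_add] at e36
  rw [e36, hρ'.r4, eval_add] at e37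
  rw [e37, hmem.input _ (by omega)] at e38
  rw [e30, hρ'.r1, eval_mul] at e39
  rw [e39, e25, eval_add] at e40
  rw [e40, hρ'.r4, eval_add] at e41
  rw [e41, hmem.input _ (by omega)] at e42
  rw [e38, e42, eval_eq] at e43
  change _ = BitVec.ofNat W (memMatch μ n a b (s / (n + 1)) (s % (n + 1))) at e43
  rw [e24, e26, eval_lt (by omega) hiW] at e44
  rw [e25, e27, eval_lt (by omega) hjW] at e45
  rw [e43, e44, eval_mul] at e46
  rw [e46, e45, eval_mul] at e47
  rw [e20, hρ'.r0, eval_eq] at e53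
  simp only [ofNat_inj hsW (show 0 < 2 ^ W by omega)] at e53
  rw [hρ'.r0, e28, eval_lt (by omega) hmW] at e55
  generalize hq : h / 2 / 2 + 1 = q at *
  have hx : memMatch μ n a b (s / (n + 1)) (s % (n + 1)) ≤ 1 := by
    unfold memMatch; split <;> omega
  have hpq := Nat.mod_lt p hMpos
  generalize memMatch μ n a b = f at *
  by_cases hm : m = 0
  · rw [if_neg (by omega)] at e55
    -- For length bound 0 the flag in register 55 cancels whatever was loaded.
    have h56 : σ 56 = BitVec.ofNat W 0 := by
      rw [e56, e55]; exact BitVec.mul_zero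
    rw [e58, h56, eval_add] at e59
    rw [e59, e34, eval_mod (by omega) (by omega)] at e60
    rw [e60, if_pos hm, add_zero, add_zero, Nat.mod_mod]
  · rw [if_pos (by omega)] at e55
    rw [hpred hm] at e51
    rw [e47, e51, eval_mul] at e52
    rw [e52, e53, eval_add] at e54
    rw [e54, e55, eval_mul, mul_one] at e56
    rw [e58, e56, eval_add] at e59
    generalize matchSum f (m - 1) (s / (n + 1)) (s % (n + 1)) = S at *
    have hSq := Nat.mod_lt S hMpos
    -- The contribution is at most (q - 1) + 1. With the old residue the sum stays below 2q, so it
    -- does not overflow before the remainder is taken.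
    have hbound : f (s / (n + 1)) (s % (n + 1)) * (if s / (n + 1) < i then 1 else 0) *
        (if s % (n + 1) < j then 1 else 0) * (S % q) + (if s = 0 then 1 else 0) ≤ q := by
      have h1 : f (s / (n + 1)) (s % (n + 1)) * (if s / (n + 1) < i then 1 else 0) *
          (if s % (n + 1) < j then 1 else 0) ≤ 1 * 1 * 1 := by
        gcongr <;> split <;> omega
      have h2 := Nat.mul_le_mul_right (S % q) h1
      have h3 : (if s = 0 then 1 else 0) ≤ 1 := by split <;> omega
      omega
    rw [e59, e34, eval_mod (by omega) (by omega)] at e60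
    rw [e60, if_neg hm]
    congr 1
    change _ ≡ _ [MOD q]
    rw [add_comm (if s = 0 then 1 else 0)]
    refine (Nat.mod_modEq p q).add (Nat.ModEq.add_right _ ?_)
    refine ((Nat.mod_modEq S q).mul_left _).trans ?_
    by_cases h1 : s / (n + 1) < i <;> by_cases h2 : s % (n + 1) < j <;> simp [h1, h2] <;> rfl

end

end BinomTable

namespace BinomTable

open WordRAM

/-! ### Correctness of the comparison and of the two loops -/

section

variable {W : ℕ}

/-- The entry of the table that counts the matches of the words `a` and `b`. -/
def memSum (μ : BitVec W → BitVec W) (n k a b : ℕ) : ℕ := matchSum (memMatch μ n a b) (k + 1) n n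

/-- Since c + 1 is a multiple of G = (k+2)(n+1)^2, the addresses are taken relative to one less than
the table start, and final cells are G apart. -/
theorem TableMem.last {μ mem : BitVec W → BitVec W} {n k h a b : ℕ}
    (hW : rounds n k + (n * 2 + 2 + (n + 1) * (n + 1)) < 2 ^ W)
    (hmem : TableMem μ n k (rounds n k) mem) (hh : h < (n + 2) * 4) (ha : a < 2) (hb : b < 2) :
    mem (BitVec.ofNat W (n * 2 + 1 + (n + 1) * (n + 1) +
      (4 * h + 2 * a + b + 1) * ((k + 2) * ((n + 1) * (n + 1))))) =
      BitVec.ofNat W (memSum μ n k a b % (h + 1)) := by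
  have h1 : 4 * h + 2 * a + b + 1 ≤ (n + 2) * 4 * 4 := by omega
  obtain ⟨c, hc⟩ : ∃ c, c + 1 = (4 * h + 2 * a + b + 1) * ((k + 2) * ((n + 1) * (n + 1))) := by
    refine ⟨_, Nat.sub_add_cancel ?_⟩
    exact Nat.succ_le_of_lt (by positivity)
  have h2 : (c + 1) * ((n + 1) * (n + 1)) ≤ rounds n k := by
    rw [hc, rounds]
    gcongr
  have h3 : c + 1 ≤ (c + 1) * ((n + 1) * (n + 1)) := Nat.le_mul_of_pos_right _ (by positivity)
  have h4 := hmem.cell c (by omega)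
  obtain ⟨h5, h6⟩ := cellValue_last n k (memMatch μ n) ha hb hc
  rw [cellPartial_eq_cellValue _ _ _ h2, h5, h6] at h4
  rw [memSum, ← h4, ← hc]
  congr 2
  ring

theorem compareCode_spec {μ mem : BitVec W → BitVec W} {ρ : ℕ → BitVec W} {n k h : ℕ}
    (hW : rounds n k + (n * 2 + 2 + (n + 1) * (n + 1)) < 2 ^ W) (hh : h < (n + 2) * 4)
    (hρ : Params n k ρ) (h63 : ρ 63 = BitVec.ofNat W h)
    (h62 : ρ 62 = BitVec.ofNat W (n * 2 + 1 + (n + 1) * (n + 1) +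
      4 * h * ((k + 2) * ((n + 1) * (n + 1)))))
    (hmem : TableMem μ n k (rounds n k) mem) :
    Params n k (runBlock mem compareCode ρ) ∧
    runBlock mem compareCode ρ 65 = BitVec.ofNat W (h + 1) ∧
    runBlock mem compareCode ρ 72 = BitVec.ofNat W (n * 2 + 1 + (n + 1) * (n + 1) +
      4 * (h + 1) * ((k + 2) * ((n + 1) * (n + 1)))) ∧
    runBlock mem compareCode ρ 78 = BitVec.ofNat W
      (if memSum μ n k 0 0 + memSum μ n k 1 1 ≡ memSum μ n k 0 1 + memSum μ n k 1 0 [MOD h + 1]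
        then 1 else 0) := by
  have E := runBlock_dest (mem := mem) compareCode (ρ := ρ) (by decide)
  have F : ∀ r < 64, runBlock mem compareCode ρ r = ρ r := fun r hr =>
    runBlock_of_notMem _ (by
      intro hmem
      have : ∀ x ∈ compareCode.map Instr.dest, 64 ≤ x := by decide
      exact absurd (this r hmem) (by omega))
  have hρ' : Params n k (runBlock mem compareCode ρ) := hρ.congr fun r hr => F r (by omega)
  have h62' := (F 62 (by norm_num)).trans h62
  have h63' := (F 63 (by norm_num)).trans h63
  generalize runBlock mem compareCode ρ = σ at *
  simp only [compareCode, List.forall_mem_cons, Instr.dest, Instr.value] at E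
  obtain ⟨e65, e66, e67, e68, e69, e70, e71, e72, e73, e74, e75, e76, e77, e78, -⟩ := E
  have c00 := hmem.last hW hh (a := 0) (b := 0) (by norm_num) (by norm_num)
  have c01 := hmem.last hW hh (a := 0) (b := 1) (by norm_num) (by norm_num)
  have c10 := hmem.last hW hh (a := 1) (b := 0) (by norm_num) (by norm_num)
  have c11 := hmem.last hW hh (a := 1) (b := 1) (by norm_num) (by norm_num)
  -- Ensures that a sum of two residues fits into a word.
  have hN : 2 * ((n + 2) * 4) ≤ rounds n k := by
    rw [rounds, mul_comm 2, mul_assoc ((n + 2) * 4), mul_assoc ((n + 2) * 4)]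
    apply Nat.mul_le_mul_left
    calc 2 ≤ 4 * ((0 + 2) * ((0 + 1) * (0 + 1))) * ((0 + 1) * (0 + 1)) := by norm_num
      _ ≤ _ := by gcongr <;> omega
  have hr14 := hρ'.r14
  generalize (k + 2) * ((n + 1) * (n + 1)) = G at *
  generalize n * 2 + 1 + (n + 1) * (n + 1) = base at *
  rw [h63', hρ'.r2, eval_add] at e65
  rw [h62', hr14, eval_add, show base + 4 * h * G + G = base + (4 * h + 2 * 0 + 0 + 1) * G by ring]
    at e66
  rw [e66, hr14, eval_add,
    show base + (4 * h + 2 * 0 + 0 + 1) * G + G = base + (4 * h + 2 * 0 + 1 + 1) * G by ring] at e68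
  rw [e68, hr14, eval_add,
    show base + (4 * h + 2 * 0 + 1 + 1) * G + G = base + (4 * h + 2 * 1 + 0 + 1) * G by ring] at e70
  rw [e70, hr14, eval_add,
    show base + (4 * h + 2 * 1 + 0 + 1) * G + G = base + (4 * h + 2 * 1 + 1 + 1) * G by ring] at e72
  rw [e66, c00] at e67
  rw [e68, c01] at e69
  rw [e70, c10] at e71
  rw [e72, c11] at e73
  have hm : ∀ x, x % (h + 1) < h + 1 := fun x => Nat.mod_lt _ (by omega)
  have m00 := hm (memSum μ n k 0 0)
  have m01 := hm (memSum μ n k 0 1)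
  have m10 := hm (memSum μ n k 1 0)
  have m11 := hm (memSum μ n k 1 1)
  rw [e67, e73, eval_add] at e74
  rw [e69, e71, eval_add] at e75
  rw [e74, e65, eval_mod (by omega) (by omega), ← Nat.add_mod] at e76
  rw [e75, e65, eval_mod (by omega) (by omega), ← Nat.add_mod] at e77
  have ma := hm (memSum μ n k 0 0 + memSum μ n k 1 1)
  have mb := hm (memSum μ n k 0 1 + memSum μ n k 1 0)
  refine ⟨hρ', e65, ?_, ?_⟩
  · rw [e72]
    congr 1
  · rw [e78, e76, e77, eval_eq]
    simp only [ofNat_inj (W := W) (ma.trans (by omega)) (mb.trans (by omega))]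
    rfl

/-- The invariant of the first loop. -/
structure FillInv (μ : BitVec W → BitVec W) (n k t : ℕ) (s : Config W) : Prop where
  pc : s.pc = 19
  params : Params n k s.reg
  r18 : s.reg 18 = BitVec.ofNat W t
  r62 : s.reg 62 = BitVec.ofNat W (n * 2 + 1 + (n + 1) * (n + 1))
  r63 : s.reg 63 = BitVec.ofNat W 0
  mem : TableMem μ n k t s.mem

/-- The invariant of the second loop. -/
structure CompareInv (μ : BitVec W → BitVec W) (n k h : ℕ) (s : Config W) : Prop where
  pc : s.pc = 65
  params : Params n k s.reg
  r62 : s.reg 62 = BitVec.ofNat W (n * 2 + 1 + (n + 1) * (n + 1) +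
    4 * h * ((k + 2) * ((n + 1) * (n + 1))))
  r63 : s.reg 63 = BitVec.ofNat W h
  mem : TableMem μ n k (rounds n k) s.mem
  agree : ∀ h' < h, memSum μ n k 0 0 + memSum μ n k 1 1 ≡
    memSum μ n k 0 1 + memSum μ n k 1 0 [MOD h' + 1]

theorem decides_of_compareInv {μ : BitVec W → BitVec W} {n k : ℕ} {s : Config W}
    (hW : rounds n k + (n * 2 + 2 + (n + 1) * (n + 1)) < 2 ^ W) (hs : CompareInv μ n k 0 s) :
    Decides program s (3 + (n + 2) * 4 * 20)
      (∀ h < (n + 2) * 4, memSum μ n k 0 0 + memSum μ n k 1 1 ≡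
        memSum μ n k 0 1 + memSum μ n k 1 0 [MOD h + 1]) := by
  have hN : (n + 2) * 4 < 2 ^ W := by
    refine lt_of_le_of_lt ?_ hW
    refine le_trans ?_ (Nat.le_add_right _ _)
    rw [rounds, mul_assoc ((n + 2) * 4), mul_assoc ((n + 2) * 4)]
    exact Nat.le_mul_of_pos_right _ (by positivity)
  -- Needed for the words 1 and 0 to differ in the conditional branches.
  have hW0 : W ≠ 0 := by
    rintro rfl
    omega
  -- A full round costs 2 + 14 + 4 = 20 instructions, the exit 3.
  refine Decides.loop (I := CompareInv μ n k) ?_ ?_ hs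
  · rintro h hh ⟨pc, ρ, mem⟩ ⟨rfl, hρ, h62, h63, hmem, hagree⟩
    dsimp only at hρ h62 h63 hmem
    have h64 : BinOp.lt.eval (ρ 63) (ρ 13) = BitVec.ofNat W 1 := by
      rw [h63, hρ.r13, eval_lt (by omega) (by omega), if_pos hh]
    obtain ⟨g1, g2, g3, g4⟩ := compareCode_spec (ρ := Function.update ρ 64 (BitVec.ofNat W 1))
      hW hh (hρ.congr fun r hr => Function.update_of_ne (by omega) _ _)
      ((Function.update_of_ne (by norm_num) _ _).trans h63)
      ((Function.update_of_ne (by norm_num) _ _).trans h62) hmem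
    have start : ∀ {B Q}, Decides program
        ⟨81, runBlock mem compareCode (Function.update ρ 64 (BitVec.ofNat W 1)), mem⟩ B Q →
        Decides program ⟨65, ρ, mem⟩ (B + 16) Q := by
      intro B Q hB
      have h1 : Decides program ⟨67, Function.update ρ 64 (BitVec.ofNat W 1), mem⟩ (B + 14) Q :=
        Decides.block compareCode hB ⟨_, rfl⟩ (by decide)
      have h2 : Decides program ⟨66, Function.update ρ 64 (BitVec.ofNat W 1), mem⟩ (B + 15) Q := by
        refine h1.step ?_
        change some _ = some _
        simp [hW0]
      refine h2.step ?_
      change some _ = some _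
      rw [h64]
      rfl
    by_cases hc : memSum μ n k 0 0 + memSum μ n k 1 1 ≡
        memSum μ n k 0 1 + memSum μ n k 1 0 [MOD h + 1]
    · right
      rw [if_pos hc] at g4
      generalize runBlock mem compareCode (Function.update ρ 64 (BitVec.ofNat W 1)) = σ at *
      refine ⟨⟨65, Function.update (Function.update σ 63 (σ 65)) 62
        (Function.update σ 63 (σ 65) 72), mem⟩, ⟨rfl, ?_, ?_, ?_, hmem, ?_⟩, fun B hB => ?_⟩
      · refine g1.congr fun r hr => ?_
        dsimp only
        rw [Function.update_of_ne (by omega), Function.update_of_ne (by omega)]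
      · dsimp only
        rw [Function.update_self, Function.update_of_ne (by norm_num), g3]
      · dsimp only
        rw [Function.update_of_ne (by norm_num), Function.update_self, g2]
      · intro h' hh'
        rcases Nat.lt_succ_iff_lt_or_eq.1 hh' with hlt | rfl
        · exact hagree h' hlt
        · exact hc
      · refine start (B := B + 4) (Decides.step (Decides.step (Decides.step (Decides.step hB
          (s := ⟨84, _, _⟩) rfl) (s := ⟨83, Function.update σ 63 (σ 65), mem⟩) rfl)
          (s := ⟨82, σ, mem⟩) rfl) (s := ⟨81, σ, mem⟩) ?_)
        change some _ = some _
        simp [g4, hW0]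
    · left
      rw [if_neg hc] at g4
      generalize runBlock mem compareCode (Function.update ρ 64 (BitVec.ofNat W 1)) = σ at *
      refine (start (B := 2) (Decides.step (s' := ⟨86, σ, mem⟩) ⟨1, false, .halt rfl, le_rfl, ?_⟩
        ?_)).mono (by norm_num)
      · simp only [Bool.false_eq_true, false_iff, not_forall]
        exact ⟨h, hh, hc⟩
      · change some _ = some _
        simp [g4]
  · rintro ⟨pc, ρ, mem⟩ ⟨rfl, hρ, h62, h63, hmem, hagree⟩
    dsimp only at hρ h62 h63 hmem
    have h64 : BinOp.lt.eval (ρ 63) (ρ 13) = BitVec.ofNat W 0 := by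
      rw [h63, hρ.r13, eval_lt (by omega) (by omega), if_neg (by omega)]
    refine Decides.step (Decides.step (s' := ⟨85, Function.update ρ 64 (BitVec.ofNat W 0), mem⟩)
      ⟨1, true, .halt rfl, le_rfl, ?_⟩ (s := ⟨66, Function.update ρ 64 (BitVec.ofNat W 0), mem⟩)
      ?_) ?_
    · simpa using hagree
    · change some _ = some _
      simp
    · change some _ = some _
      rw [h64]
      rfl

theorem decides_of_fillInv {μ : BitVec W → BitVec W} {n k : ℕ} {s : Config W} (hk : k ≤ n)
    (hW : rounds n k + (n * 2 + 2 + (n + 1) * (n + 1)) < 2 ^ W) (hs : FillInv μ n k 0 s) :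
    Decides program s (3 + (n + 2) * 4 * 20 + 2 + rounds n k * 46)
      (∀ h < (n + 2) * 4, memSum μ n k 0 0 + memSum μ n k 1 1 ≡
        memSum μ n k 0 1 + memSum μ n k 1 0 [MOD h + 1]) := by
  have hW0 : W ≠ 0 := by
    rintro rfl
    omega
  -- A round costs 2 + 41 + 3 = 46 instructions; the exit costs 2 before the second loop.
  refine Decides.loop (I := FillInv μ n k) ?_ ?_ hs
  · rintro t ht ⟨pc, ρ, mem⟩ ⟨rfl, hρ, h18, h62, h63, hmem⟩
    dsimp only at hρ h18 h62 h63 hmem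
    right
    have h19 : BinOp.lt.eval (ρ 18) (ρ 17) = BitVec.ofNat W 1 := by
      rw [h18, hρ.r17, eval_lt (by omega) (by omega), if_pos ht]
    obtain ⟨g1, g2⟩ := fillCode_spec (ρ := Function.update ρ 19 (BitVec.ofNat W 1)) hk hW ht
      (hρ.congr fun r hr => Function.update_of_ne (by omega) _ _)
      ((Function.update_of_ne (by norm_num) _ _).trans h18) hmem
    have F : ∀ r, r < 19 ∨ 61 ≤ r →
        runBlock mem fillCode (Function.update ρ 19 (BitVec.ofNat W 1)) r = ρ r := by
      intro r hr
      rw [runBlock_of_notMem, Function.update_of_ne (by omega)]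
      intro hmem
      have : ∀ x ∈ fillCode.map Instr.dest, 19 ≤ x ∧ x < 61 := by decide
      have := this r hmem
      omega
    have start : ∀ {B Q}, Decides program
        ⟨62, runBlock mem fillCode (Function.update ρ 19 (BitVec.ofNat W 1)), mem⟩ B Q →
        Decides program ⟨19, ρ, mem⟩ (B + 43) Q := by
      intro B Q hB
      have h1 : Decides program ⟨21, Function.update ρ 19 (BitVec.ofNat W 1), mem⟩ (B + 41) Q :=
        Decides.block fillCode hB ⟨_, rfl⟩ (by decide)
      have h2 : Decides program ⟨20, Function.update ρ 19 (BitVec.ofNat W 1), mem⟩ (B + 42) Q := by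
        refine h1.step ?_
        change some _ = some _
        simp [hW0]
      refine h2.step ?_
      change some _ = some _
      rw [h19]
      rfl
    generalize runBlock mem fillCode (Function.update ρ 19 (BitVec.ofNat W 1)) = σ at *
    refine ⟨⟨19, Function.update σ 18 (BinOp.add.eval (σ 18) (σ 2)),
      Function.update mem (σ 57) (σ 60)⟩, ⟨rfl, ?_, ?_, ?_, ?_, ?_⟩, fun B hB => ?_⟩
    · refine hρ.congr fun r hr => ?_
      dsimp only
      rw [Function.update_of_ne (by omega), F r (by omega)]
    · dsimp only
      rw [Function.update_self, F 18 (by norm_num), F 2 (by norm_num), h18, hρ.r2, eval_add]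
    · dsimp only
      rw [Function.update_of_ne (by norm_num), F 62 (by norm_num), h62]
    · dsimp only
      rw [Function.update_of_ne (by norm_num), F 63 (by norm_num), h63]
    · dsimp only
      rw [g1, g2]
      exact hmem.succ (by omega) rfl
    · exact start (B := B + 3) (Decides.step (Decides.step (Decides.step hB
        (s := ⟨64, Function.update σ 18 (BinOp.add.eval (σ 18) (σ 2)),
          Function.update mem (σ 57) (σ 60)⟩) rfl)
        (s := ⟨63, σ, Function.update mem (σ 57) (σ 60)⟩) rfl) (s := ⟨62, σ, mem⟩) rfl)
  · rintro ⟨pc, ρ, mem⟩ ⟨rfl, hρ, h18, h62, h63, hmem⟩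
    dsimp only at hρ h18 h62 h63 hmem
    have h19 : BinOp.lt.eval (ρ 18) (ρ 17) = BitVec.ofNat W 0 := by
      rw [h18, hρ.r17, eval_lt (by omega) (by omega), if_neg (by omega)]
    have hU : ∀ r ≠ 19, Function.update ρ 19 (BitVec.ofNat W 0) r = ρ r :=
      fun r hr => Function.update_of_ne hr _ _
    refine Decides.step (Decides.step (decides_of_compareInv
      (s := ⟨65, Function.update ρ 19 (BitVec.ofNat W 0), mem⟩) hW
      ⟨rfl, hρ.congr fun r hr => hU r (by omega), ?_, (hU 63 (by norm_num)).trans h63, hmem,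
        by simp⟩) (s := ⟨20, Function.update ρ 19 (BitVec.ofNat W 0), mem⟩) ?_) ?_
    · rw [mul_zero, zero_mul, add_zero]
      exact (hU 62 (by norm_num)).trans h62
    · change some _ = some _
      simp
    · change some _ = some _
      rw [h19]
      rfl

/-- The program started on a memory with an array of `2 n + 2` words. -/
theorem program_decides {μ : BitVec W → BitVec W} {n k : ℕ} (hk : k ≤ n)
    (hW : rounds n k + (n * 2 + 2 + (n + 1) * (n + 1)) < 2 ^ W)
    (h0 : μ (BitVec.ofNat W 0) = BitVec.ofNat W n) (h1 : μ (BitVec.ofNat W 1) = BitVec.ofNat W k)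
    (hz : ∀ x, n * 2 + 2 ≤ x → x < 2 ^ W → μ (BitVec.ofNat W x) = BitVec.ofNat W 0) :
    Decides program ⟨0, fun _ => 0, μ⟩ (3 + (n + 2) * 4 * 20 + 2 + rounds n k * 46 + 19)
      (∀ h < (n + 2) * 4, memSum μ n k 0 0 + memSum μ n k 1 1 ≡
        memSum μ n k 0 1 + memSum μ n k 1 0 [MOD h + 1]) := by
  refine Decides.block setupCode (decides_of_fillInv hk hW ?_) ⟨_, rfl⟩ (by decide)
  have E := runBlock_dest (mem := μ) setupCode (ρ := fun _ => 0) (by decide)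
  have F : ∀ r ∉ setupCode.map Instr.dest, runBlock μ setupCode (fun _ => 0) r =
    BitVec.ofNat W 0 := fun r hr => runBlock_of_notMem _ hr
  have f0 := F 0 (by decide)
  have f18 := F 18 (by decide)
  have f63 := F 63 (by decide)
  generalize runBlock μ setupCode (fun _ => 0) = σ at *
  simp only [setupCode, List.forall_mem_cons, Instr.dest, Instr.value] at E
  obtain ⟨e1, e2, e3, e4, e5, e6, e7, e8, e9, e10, e12, e11, e13, e14, e15, e16, e17, e61, e62,
    -⟩ := E
  rw [f0, h0] at e1
  rw [e2, h1] at e3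
  rw [e3, e4, eval_add] at e5
  rw [e1, e2, eval_add] at e6
  rw [e6, eval_mul] at e7
  rw [e1, e4, eval_mul] at e8
  rw [e8, e4, eval_add] at e9
  rw [e9, e7, eval_add] at e10
  rw [e1, e4, eval_add] at e11
  rw [e11, e12, eval_mul] at e13
  rw [e5, e7, eval_mul] at e14
  rw [e13, e12, eval_mul] at e15
  rw [e15, e14, eval_mul] at e16
  rw [e16, e7, eval_mul] at e17
  rw [e8, e2, eval_add] at e61
  rw [e61, e7, eval_add] at e62
  exact ⟨rfl, ⟨f0, e1, e2, e4, e5, e6, e7, e9, e10, e13, e14, e17⟩, f18, e62, f63,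
    fun x _ => rfl, fun c hc => by
      -- The zero cells beyond the input represent the empty partial sums.
      rw [cellPartial_zero, Nat.zero_mod]
      exact hz _ (by omega) hc⟩

end

end BinomTable

/-! ### Word size, and from memory contents back to words -/

namespace BinomTable

open WordRAM

/-- All addresses and counters are at most 17(n+2)^6 < 2^6 (n+2)^6. With y = 2^(⌊log n⌋+1) one has 2
≤ y and n + 2 ≤ y^2, which gives y^6 · y^12 = y^18. -/
theorem rounds_add_lt {W n k : ℕ} (hk : k ≤ n) (hW : 18 * (Nat.log 2 n + 1) ≤ W) :
    rounds n k + (n * 2 + 2 + (n + 1) * (n + 1)) < 2 ^ W := by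
  refine lt_of_lt_of_le ?_ (Nat.pow_le_pow_right (by norm_num) hW)
  rw [mul_comm 18, pow_mul]
  have h1 : n < 2 ^ (Nat.log 2 n + 1) := Nat.lt_pow_succ_log_self (by norm_num) n
  have h2 : 2 ^ 1 ≤ 2 ^ (Nat.log 2 n + 1) := Nat.pow_le_pow_right (by norm_num) (by omega)
  generalize 2 ^ (Nat.log 2 n + 1) = y at *
  have h3 : n + 2 ≤ y ^ 2 := by nlinarith
  have h4 : rounds n k ≤ 16 * (n + 2) ^ 6 := by
    calc rounds n k ≤ (n + 2) * 4 * 4 * ((n + 2) * ((n + 2) * (n + 2))) * ((n + 2) * (n + 2)) := by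
          rw [rounds]; gcongr <;> omega
      _ = 16 * (n + 2) ^ 6 := by ring
  have h5 : n * 2 + 2 + (n + 1) * (n + 1) ≤ (n + 2) ^ 2 := by nlinarith
  have h6 : (n + 2) ^ 2 ≤ (n + 2) ^ 6 := Nat.pow_le_pow_right (by omega) (by norm_num)
  calc rounds n k + (n * 2 + 2 + (n + 1) * (n + 1)) ≤ 17 * (n + 2) ^ 6 := by omega
    _ < 2 ^ 6 * (n + 2) ^ 6 := by
        have : 0 < (n + 2) ^ 6 := by positivity
        omega
    _ ≤ y ^ 6 * (y ^ 2) ^ 6 := by gcongr; omega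
    _ = y ^ 18 := by ring

section

variable {A : Type*} {W n k : ℕ} {code : A → BitVec W} {w₁ w₂ : List A}

theorem initial_mem_ofNat (l : List (BitVec W)) {x : ℕ} (hx : x < 2 ^ W) :
    (initial l).mem (BitVec.ofNat W x) = l.getD x 0 := by
  simp only [initial, toNat_ofNat_of_lt hx]

/-- The offset 2 skips n and k, and injectivity of the coding turns equal codes into equal letters.
-/
theorem memMatch_binomInput (hcode : Function.Injective code) (h₁ : w₁.length = n)
    (h₂ : w₂.length = n) (hW : n * 2 + 2 < 2 ^ W) (d : A) {a b i j : ℕ} (ha : a < 2) (hb : b < 2)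
    (hi : i < n) (hj : j < n) :
    memMatch (initial (binomInput code k w₁ w₂)).mem n a b i j =
      letterMatch ((if a = 0 then w₁ else w₂).getD · d) ((if b = 0 then w₁ else w₂).getD · d)
        i j := by
  have key : ∀ a < 2, ∀ i < n,
      (initial (binomInput code k w₁ w₂)).mem (BitVec.ofNat W (a * n + i + 2)) =
        code ((if a = 0 then w₁ else w₂).getD i d) := by
    intro a ha i hi
    have han : a * n ≤ n := (Nat.mul_le_mul_right n (Nat.lt_succ_iff.1 ha)).trans (by omega)
    rw [initial_mem_ofNat _ (by omega), binomInput, List.getD_cons_succ, List.getD_cons_succ]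
    interval_cases a
    · rw [List.getD_append _ _ _ _ (by simp; omega), List.getD_eq_getElem _ _ (by simp; omega)]
      simp [h₁, hi]
    · rw [List.getD_append_right _ _ _ _ (by simp; omega),
        List.getD_eq_getElem _ _ (by simp; omega)]
      simp [h₁, h₂, hi]
  rw [memMatch, letterMatch, key a ha i hi, key b hb j hj]
  classical exact if_congr hcode.eq_iff rfl rfl

theorem agree_iff_binomEquiv [Finite A] [Nonempty A] (hcode : Function.Injective code)
    (h₁ : w₁.length = n) (h₂ : w₂.length = n) (hW : n * 2 + 2 < 2 ^ W) :
    (∀ h < (n + 2) * 4,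
      memSum (initial (binomInput code k w₁ w₂)).mem n k 0 0 +
        memSum (initial (binomInput code k w₁ w₂)).mem n k 1 1 ≡
      memSum (initial (binomInput code k w₁ w₂)).mem n k 0 1 +
        memSum (initial (binomInput code k w₁ w₂)).mem n k 1 0 [MOD h + 1]) ↔
      BinomEquiv k w₁ w₂ := by
  obtain ⟨d⟩ := ‹Nonempty A›
  have hsum : ∀ a < 2, ∀ b < 2, memSum (initial (binomInput code k w₁ w₂)).mem n k a b =
      matchSum (letterMatch ((if a = 0 then w₁ else w₂).getD · d)
        ((if b = 0 then w₁ else w₂).getD · d)) (k + 1) n n := fun a ha b hb =>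
    matchSum_congr (fun i hi j hj => memMatch_binomInput hcode h₁ h₂ hW d ha hb hi hj) (k + 1)
      n le_rfl n le_rfl
  have hle : ∀ u v : ℕ → A, matchSum (letterMatch u v) (k + 1) n n ≤ 2 ^ n * 2 ^ n := fun u v =>
    matchSum_le (fun i j => by unfold letterMatch; split <;> omega) _ _ _
  rw [hsum 0 (by norm_num) 0 (by norm_num), hsum 0 (by norm_num) 1 (by norm_num),
    hsum 1 (by norm_num) 0 (by norm_num), hsum 1 (by norm_num) 1 (by norm_num),
    binomEquiv_iff_matchSum d k n w₁ w₂ h₁ h₂]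
  simp only [if_true, one_ne_zero, if_false]
  have l00 := hle (w₁.getD · d) (w₁.getD · d)
  have l01 := hle (w₁.getD · d) (w₂.getD · d)
  have l10 := hle (w₂.getD · d) (w₁.getD · d)
  have l11 := hle (w₂.getD · d) (w₂.getD · d)
  generalize matchSum (letterMatch (w₁.getD · d) (w₁.getD · d)) (k + 1) n n = s00 at *
  generalize matchSum (letterMatch (w₁.getD · d) (w₂.getD · d)) (k + 1) n n = s01 at *
  generalize matchSum (letterMatch (w₂.getD · d) (w₁.getD · d)) (k + 1) n n = s10 at *
  generalize matchSum (letterMatch (w₂.getD · d) (w₂.getD · d)) (k + 1) n n = s11 at *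
  constructor
  · intro h
    rw [← Int.natAbs_eq_zero]
    -- Each of the four sums is at most 4^n, so the absolute difference is at most 2·4^n.
    refine eq_zero_of_forall_dvd (n := n) (by omega) fun M hM hM' => ?_
    have h1 := h (M - 1) (by omega)
    rw [Nat.sub_add_cancel hM] at h1
    have h2 := h1.symm.dvd
    push_cast at h2
    exact Int.natCast_dvd.1 h2
  · intro h m _
    have : s00 + s11 = s01 + s10 := by omega
    rw [this]

end

end BinomTable

theorem theorem1 :
    ∃ (P : WordRAM.Program) (c : ℕ) (p : Polynomial ℕ),
      ∀ (A : Type*) [Finite A] [Nonempty A] (W n k : ℕ) (code : A → BitVec W) (w₁ w₂ : List A),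
        Function.Injective code →
        c * (Nat.log 2 n + 1) ≤ W →
        w₁.length = n → w₂.length = n → k ≤ n →
        ∃ (t : ℕ) (answer : Bool),
          WordRAM.HaltsIn P (WordRAM.initial (binomInput code k w₁ w₂)) t answer ∧
          t ≤ p.eval n ∧
          (answer = true ↔ BinomEquiv k w₁ w₂) := by
  -- The polynomial is the running time with k replaced by n; 24 = 3 + 2 + 19 collects the loop
  -- exits and the setup.
  refine ⟨BinomTable.program, 18, 24 + (.X + 2) * 4 * 20 + (.X + 2) * 4 * 4 *
    ((.X + 2) * ((.X + 1) * (.X + 1))) * ((.X + 1) * (.X + 1)) * 46, ?_⟩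
  intro A _ _ W n k code w₁ w₂ hcode hW h₁ h₂ hk
  have hlt := BinomTable.rounds_add_lt hk hW
  have hlen : (binomInput code k w₁ w₂).length = n * 2 + 2 := by
    simp [binomInput, h₁, h₂]
    ring
  have h := BinomTable.program_decides (μ := (WordRAM.initial (binomInput code k w₁ w₂)).mem)
    hk hlt
    (by rw [BinomTable.initial_mem_ofNat _ (by omega), binomInput, h₁]; rfl)
    (by rw [BinomTable.initial_mem_ofNat _ (by omega)]; rfl)
    (fun x hx hx' => by
      rw [BinomTable.initial_mem_ofNat _ hx', List.getD_eq_default _ _ (by omega)]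
      rfl)
  refine (h.congr (BinomTable.agree_iff_binomEquiv hcode h₁ h₂ (by omega))).mono ?_
  have hr : BinomTable.rounds n k ≤ BinomTable.rounds n n := by
    unfold BinomTable.rounds
    gcongr
  simp only [Polynomial.eval_add, Polynomial.eval_mul, Polynomial.eval_X, Polynomial.eval_ofNat,
    Polynomial.eval_one]
  rw [← BinomTable.rounds]
  omega
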